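/- **Setting.** Let $\mathcal V$ be a finite set of sites, each carrying a nonzero finite-dimensional Hilbert space $\mathcal H_{\{x\}}$, and $\mathcal H=\bigotimes_{x\in\mathcal V}\mathcal H_{\{x\}}$. Let $\mathcal E$ be a set of subsets of $\mathcal V$ (the edges), for each $X\in\mathcal E$ let $\hat H_X$ be a self-adjoint operator on $\mathcal H$ supported in $X$ (i.e. of the form $\hat O_X\otimes\hat{\mathbb I}_{\mathcal V\setminus X}$), and let $\hat H=\sum_{X\in\mathcal E}\hat H_X$. For sites $x\neq y$ let $d(x,y)$ be the smallest $d$ for which there are $X_1,\dots,X_d\in\mathcal E$ with $x\in X_1$, $y\in X_d$ and $X_i\cap X_{i+1}\ne\emptyset$ for $1\le i<d$ ($d(x,y)=\infty$ if there is no such sequence), and let $d(x,x)=0$. Put $d(x,Y)=\min_{y\in Y}d(x,y)$ and $d(X,Y)=\min_{x\in X}d(x,Y)$, a minimum over the empty set being $\infty$. For $X\subset\mathcal V$ let $X_\partial=\{Y\in\mathcal E: Y\cap X\neq\emptyset,\ Y\cap(\mathcal V\setminus X)\neq\emptyset\}$. Put $J=\max_{X\in\mathcal E}\|\hat H_X\|_\infty$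 (operator norm) and $N_\partial=\max_{X\in\mathcal E}|X_\partial|$ (both $0$ if $\mathcal E=\emptyset$). Let $M>0$ be such that $|\{Y\in\mathcal E:d(x,Y)=n\}|\le M(n+1)^2$ for all $x\in\mathcal V$ and all integers $n\ge 0$. For $\beta\in\mathbb R$ let $\hat\omega(\beta)=e^{-\beta\hat H}/\mathrm{Tr}\,e^{-\beta\hat H}$, $\langle\hat O\rangle_\beta=\mathrm{Tr}[\hat O\hat\omega(\beta)]$ and $\mathrm{Var}_\beta\hat O=\langle\hat O^2\rangle_\beta-\langle\hat O\rangle_\beta^2$. Suppose that for every $|\beta|<\beta^*$ there is a correlation length $\xi(\beta)>0$: for all disjoint $X,Y\subset\mathcal V$ and all self-adjoint $\hat O_X,\hat O_Y$ supported in $X$ and in $Y$ respectively, $$\left|\langle\hat O_X\hat O_Y\rangle_\beta-\langle\hat O_X\rangle_\beta\langle\hat O_Y\rangle_\beta\right|\le 4(\xi(\beta)+1)\min(|X_\partial|,|Y_\partial|)\,\|\hat O_X\|_\infty\|\hat O_Y\|_\infty\,e^{-d(X,Y)/\xi(\beta)},\qquad e^{-\infty}:=0 .$$ Let $A\subset\mathcal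 V$, let $\hat\rho(\beta)=\mathrm{Tr}_{\mathcal V\setminus A}\,\hat\omega(\beta)$ be the reduced state on $A$, and let $$F(\beta)=\sum_{i,j}\frac{2\,|\langle i|\frac{d}{d\beta}\hat\rho(\beta)|j\rangle|^2}{p_i+p_j}$$ be its quantum Fisher information, where $|i\rangle$ is an orthonormal basis of eigenvectors of $\hat\rho(\beta)$ with eigenvalues $p_i$. Let $\mathcal A=\{X\in\mathcal E:X\subset A\}$, and for $R\in\mathbb N$ let $\mathcal C_R=\{X\in\mathcal E\setminus\mathcal A:d(X,A)<R\}$. Put $\hat H_A=\sum_{X\in\mathcal A}\hat H_X$ and $\hat H_{\mathcal C_R}=\sum_{X\in\mathcal C_R}\hat H_X$. **Theorem.** For every $\beta$ with $|\beta|<\beta^*$ and every $R\in\mathbb N$ with $R\ge 2\xi(\beta)+1$, $$\left|\sqrt{F(\beta)}-\sqrt{\mathrm{Var}_\beta\hat H_A}\right|\le\sqrt{\mathrm{Var}_\beta\hat H_{\mathcal C_R}}+40\,J\,M\,|A|\sqrt{N_\partial}\,(\xi(\beta)+1)^{3/2}\,R^2\,e^{-R/(2\xi(\beta))}.$$ 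-/

import Mathlib

noncomputable section

open scoped Kronecker

/-- The splitting of a configuration of the whole lattice into its restrictions to `X` and to the
complement of `X`. On Hilbert spaces it is the identification of the tensor product over all sites
with the tensor product of the Hilbert space of `X` and that of its complement. -/
def splitSites {V : Type*} [DecidableEq V] (σ : V → Type*) (X : Finset V) :
    (∀ x, σ x) ≃ (∀ x : {x // x ∈ X}, σ x) × (∀ x : {x // x ∉ X}, σ x) :=
  Equiv.piEquivPiSubtypeProd (fun x => x ∈ X) σ

/-- Operators on the global Hilbert space, the tensor product over all sites `x` of `ℂ^(σ x)`,
written in its product basis. -/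
abbrev GlobalOp {V : Type*} (σ : V → Type*) := Matrix (∀ x, σ x) (∀ x, σ x) ℂ

/-- Operators on the Hilbert space of the subsystem `X`. -/
abbrev LocalOp {V : Type*} (σ : V → Type*) (X : Finset V) :=
  Matrix (∀ x : {x // x ∈ X}, σ x) (∀ x : {x // x ∈ X}, σ x) ℂ

/-- The operator norm of a matrix, acting on the Euclidean (Hilbert) space. -/
def opNorm {n : Type*} [Fintype n] [DecidableEq n] (O : Matrix n n ℂ) : ℝ :=
  ‖Matrix.toEuclideanCLM (n := n) (𝕜 := ℂ) O‖

/-- The Bures norm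
`‖O‖_ρ = √(∑ i j, 2 |⟨i|O|j⟩|² / (p i + p j))`, where `|i⟩` is an orthonormal basis of
eigenvectors of the Hermitian matrix `ρ` (here: the columns of a unitary) and `p i` are the
eigenvalues. -/
def buresNorm {n : Type*} [Fintype n] [DecidableEq n] {ρ : Matrix n n ℂ} (hρ : ρ.IsHermitian)
    (O : Matrix n n ℂ) : ℝ :=
  √(∑ i, ∑ j,
    2 * ‖(star (hρ.eigenvectorUnitary : Matrix n n ℂ) * O *
      (hρ.eigenvectorUnitary : Matrix n n ℂ)) i j‖ ^ 2 / (hρ.eigenvalues i + hρ.eigenvalues j))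

section Operators

variable {V : Type*} [Fintype V] [DecidableEq V] {σ : V → Type*}

/-- `O ⊗ 𝟙`, as an operator on the global Hilbert space, for an operator `O` on that of `X`. -/
def embedOp [∀ x, DecidableEq (σ x)] (X : Finset V) (O : LocalOp σ X) : GlobalOp σ :=
  (O ⊗ₖ (1 : Matrix (∀ x : {x // x ∉ X}, σ x) (∀ x : {x // x ∉ X}, σ x) ℂ)).submatrix
    (splitSites σ X) (splitSites σ X)

/-- The support of `O` is contained in `X`: `O` acts like the identity outside `X`. -/
def SupportedIn [∀ x, DecidableEq (σ x)] (X : Finset V) (O : GlobalOp σ) : Prop :=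
  ∃ O' : LocalOp σ X, O = embedOp X O'

/-- The partial trace over the complement of `A`. -/
def partialTrace [∀ x, Fintype (σ x)] (A : Finset V) (O : GlobalOp σ) : LocalOp σ A :=
  Matrix.of fun a a' => ∑ b : ∀ x : {x // x ∉ A}, σ x,
    O ((splitSites σ A).symm (a, b)) ((splitSites σ A).symm (a', b))

/-- The partial trace of a Hermitian operator is Hermitian. -/
theorem partialTrace_isHermitian [∀ x, Fintype (σ x)] (A : Finset V) {O : GlobalOp σ}
    (hO : O.IsHermitian) : (partialTrace A O).IsHermitian := by
  ext a a'
  simp only [partialTrace, Matrix.conjTranspose_apply, Matrix.of_apply, star_sum]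
  exact Finset.sum_congr rfl fun b _ => hO.apply _ _

end Operators

/-- A quantum many-body system on a finite set `V` of sites, the site `x` having Hilbert space
`ℂ^(σ x)`: a set of edges (subsystems), and for every edge `X` a self-adjoint Hamiltonian term
supported in `X`. (The value of `term` outside `edges` plays no role.) -/
structure LatticeSystem (V : Type*) [Fintype V] [DecidableEq V] (σ : V → Type*)
    [∀ x, DecidableEq (σ x)] where
  edges : Finset (Finset V)
  term : Finset V → GlobalOp σ
  isHermitian_term : ∀ X ∈ edges, (term X).IsHermitian
  supportedIn_term : ∀ X ∈ edges, SupportedIn X (term X)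

namespace LatticeSystem

variable {V : Type*} [Fintype V] [DecidableEq V] {σ : V → Type*} [∀ x, DecidableEq (σ x)]

/-! ### Geometry of the lattice -/

/-- The sequence `L = [X₁, …, X_d]` of edges leads from `x` to `y`: `x ∈ X₁`, `y ∈ X_d`, and
consecutive edges intersect. -/
def IsEdgePath (S : LatticeSystem V σ) (x y : V) (L : List (Finset V)) : Prop :=
  (∀ X ∈ L, X ∈ S.edges) ∧ L.IsChain (fun X Y => (X ∩ Y).Nonempty) ∧
    (∃ X ∈ L.head?, x ∈ X) ∧ (∃ Y ∈ L.getLast?, y ∈ Y)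

/-- The distance of two sites: the length of the shortest sequence of edges from `x` to `y`. It is
`0` if `x = y` (the empty sequence), and `⊤` if there is no such sequence. -/
def siteDist (S : LatticeSystem V σ) (x y : V) : ℕ∞ :=
  if x = y then 0 else ⨅ (L : List (Finset V)) (_ : S.IsEdgePath x y L), (L.length : ℕ∞)

/-- The distance of a site and a subsystem. -/
def distTo (S : LatticeSystem V σ) (x : V) (Y : Finset V) : ℕ∞ := ⨅ y ∈ Y, S.siteDist x y

/-- The distance of two subsystems. -/
def setDist (S : LatticeSystem V σ) (X Y : Finset V) : ℕ∞ := ⨅ x ∈ X, S.distTo x Y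

/-- The boundary edges of a subsystem `X`: those that overlap with `X` and with its complement. -/
def boundary (S : LatticeSystem V σ) (X : Finset V) : Finset (Finset V) :=
  {Y ∈ S.edges | (Y ∩ X).Nonempty ∧ (Y ∩ Xᶜ).Nonempty}

/-- `N_∂`, the largest size of the boundary of an edge (`0` if there are no edges). -/
def maxBoundary (S : LatticeSystem V σ) : ℕ := S.edges.sup fun X => (S.boundary X).card

/-- The number of edges at distance `n` from a given site is at most `M (n + 1)²`. -/
def QuadraticGrowth (S : LatticeSystem V σ) (M : ℝ) : Prop :=
  ∀ (x : V) (n : ℕ), (({Y ∈ S.edges | S.distTo x Y = n} : Finset (Finset V)).card : ℝ) ≤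
    M * ((n : ℝ) + 1) ^ 2

/-- The edges contained in `A`. -/
def innerEdges (S : LatticeSystem V σ) (A : Finset V) : Finset (Finset V) :=
  {X ∈ S.edges | X ⊆ A}

/-- `C_R`, the edges that are not contained in `A` and have distance less than `R` from `A`. -/
def layer (S : LatticeSystem V σ) (A : Finset V) (R : ℕ) : Finset (Finset V) :=
  {X ∈ S.edges \ S.innerEdges A | S.setDist X A < R}

/-! ### Hamiltonians and thermal states -/

/-- The sum of the Hamiltonian terms of a set of edges. -/
def ham (S : LatticeSystem V σ) (G : Finset (Finset V)) : GlobalOp σ := ∑ X ∈ G, S.term X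

theorem ham_edges_isHermitian (S : LatticeSystem V σ) : (S.ham S.edges).IsHermitian := by
  unfold ham Matrix.IsHermitian
  rw [Matrix.conjTranspose_sum]
  exact Finset.sum_congr rfl fun X hX => S.isHermitian_term X hX

variable [∀ x, Fintype (σ x)]

/-- `J`, the largest operator norm of a Hamiltonian term (`0` if there are no edges). -/
def strength (S : LatticeSystem V σ) : ℝ := ⨆ X : {X // X ∈ S.edges}, opNorm (S.term X)

/-- The unnormalized Gibbs operator `e^{-β H}`, with `H` the sum of all terms. -/
def gibbsWeight (S : LatticeSystem V σ) (β : ℝ) : GlobalOp σ :=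
  NormedSpace.exp (-β • S.ham S.edges)

/-- The global Gibbs state `e^{-β H} / Tr e^{-β H}`. -/
def gibbs (S : LatticeSystem V σ) (β : ℝ) : GlobalOp σ :=
  (S.gibbsWeight β).trace⁻¹ • S.gibbsWeight β

theorem gibbs_isHermitian (S : LatticeSystem V σ) (β : ℝ) : (S.gibbs β).IsHermitian := by
  have h : (S.gibbsWeight β).IsHermitian := by
    apply Matrix.IsHermitian.exp
    unfold Matrix.IsHermitian
    rw [Matrix.conjTranspose_smul, S.ham_edges_isHermitian]
    simp
  unfold gibbs Matrix.IsHermitian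
  rw [Matrix.conjTranspose_smul, h, star_inv₀, ← Matrix.trace_conjTranspose, h]

/-- The thermal expectation value `⟨O⟩_β`. -/
def expect (S : LatticeSystem V σ) (β : ℝ) (O : GlobalOp σ) : ℂ := (O * S.gibbs β).trace

/-- The thermal variance `⟨O²⟩_β - ⟨O⟩_β²` of an observable (a real number, as `O` is Hermitian). -/
def variance (S : LatticeSystem V σ) (β : ℝ) (O : GlobalOp σ) : ℝ :=
  (S.expect β (O * O) - S.expect β O ^ 2).re

/-- The reduced state of the subsystem `A`. -/
def reduced (S : LatticeSystem V σ) (A : Finset V) (β : ℝ) : LocalOp σ A :=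
  partialTrace A (S.gibbs β)

theorem reduced_isHermitian (S : LatticeSystem V σ) (A : Finset V) (β : ℝ) :
    (S.reduced A β).IsHermitian :=
  partialTrace_isHermitian A (S.gibbs_isHermitian β)

/-- The derivative in `β`, entry by entry, of the reduced state. -/
def reducedDeriv (S : LatticeSystem V σ) (A : Finset V) (β : ℝ) : LocalOp σ A :=
  Matrix.of fun a a' => deriv (fun b : ℝ => S.reduced A b a a') β

/-- The quantum Fisher information `F(β) = ‖dρ/dβ‖²_ρ` of the family of reduced states of `A`. -/
def fisher (S : LatticeSystem V σ) (A : Finset V) (β : ℝ) : ℝ :=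
  buresNorm (S.reduced_isHermitian A β) (S.reducedDeriv A β) ^ 2

/-- `e^{-d/ξ}` for a distance `d`, with `e^{-∞} = 0`. -/
def decay (ξ : ℝ) (d : ℕ∞) : ℝ := if d = ⊤ then 0 else Real.exp (-(d.toNat : ℝ) / ξ)

/-- `ξ` is a correlation length of the system at inverse temperature `β`: exponential clustering of
the correlations of observables with disjoint supports. -/
def IsCorrelationLength (S : LatticeSystem V σ) (β ξ : ℝ) : Prop :=
  0 < ξ ∧ ∀ (X Y : Finset V) (O P : GlobalOp σ), Disjoint X Y →
    O.IsHermitian → P.IsHermitian → SupportedIn X O → SupportedIn Y P →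
      ‖S.expect β (O * P) - S.expect β O * S.expect β P‖ ≤
        4 * (ξ + 1) * (min (S.boundary X).card (S.boundary Y).card : ℕ) *
          opNorm O * opNorm P * decay ξ (S.setDist X Y)

end LatticeSystem

end

/-!
The argument takes place in the Bures norm `‖·‖_ρ` of the reduced state `ρ = Tr_{Aᶜ} ω`, where
`ω` is the Gibbs state: by definition `√F = ‖dρ/dβ‖_ρ`.

Write `A ∘ B = (A B + B A) / 2`. As the Hamiltonian commutes with `ω`,
`dω/dβ = -(H - ⟨H⟩) ∘ ω`, so `dρ/dβ` is minus the sum over the edges of the *responses*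
`Tr_{Aᶜ} ((H_X - ⟨H_X⟩) ∘ ω)`. The triangle inequality for `‖·‖_ρ` reduces the theorem to three
estimates of responses.

* For an observable `O` supported in `A` the partial trace does nothing, and the norm of the response
  is exactly `√(Var O)` (`buresNorm_response_of_supportedIn`).
* For any observable it is at most `√(Var O)` (`buresNorm_response_le`). This is monotonicity of the
  Bures norm under the partial trace; it follows from the Cauchy–Schwarz inequality for the form
  `Re Tr (ω · ·)`, tested against the symmetric logarithmic derivative of the response.
* For a term `P = H_X` with `X` disjoint from `A` it is exponentially small in the distance of `X`
  and `A` (`buresNorm_response_term_le`). Put `T = Tr_{Aᶜ} (P ∘ ω)` and `K = ρ^{-1/2} T ρ^{-1/2}`.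
  As `2 / (p + q) ≤ 1 / √(p q)`, the squared norm of the response `T - ⟨P⟩ ρ` is at most
  `Tr ((T - ⟨P⟩ ρ) ρ^{-1/2} (T - ⟨P⟩ ρ) ρ^{-1/2}) = ⟨P K⟩ - ⟨P⟩ ⟨K⟩`, which is a correlation of
  observables with disjoint supports. Moreover `‖K‖ ≤ ‖P‖`, because `O ↦ Tr_{Aᶜ} (O ∘ ω)` is
  positive on operators supported away from `A`, and so `-‖P‖ ρ ≤ T ≤ ‖P‖ ρ`. Exponential
  clustering now applies, and taking the square root halves the decay rate
  (`exists_opNorm_le_buresNorm_sq_le`).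

The edges that are neither inside `A` nor in the layer have distance at least `R` from `A`, and by
quadratic growth their contributions sum to at most a multiple of
`∑_{n ≥ R} (n + 1)² e^{-n / (2 ξ)}`, which is evaluated by telescoping (`sum_Ico_sq_mul_pow_le`).
-/

/-! ### The Bures norm -/

section BuresNorm

open Matrix
open scoped ComplexOrder

variable {n : Type*} [Fintype n]

/-- The symmetrized product `(A B + B A) / 2` of two operators. -/
noncomputable def symMul (A B : Matrix n n ℂ) : Matrix n n ℂ := (1 / 2 : ℂ) • (A * B + B * A)

theorem symMul_add_left (A B C : Matrix n n ℂ) : symMul (A + B) C = symMul A C + symMul B C := by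
  simp only [symMul, add_mul, mul_add, ← smul_add]
  congr 1
  abel

theorem symMul_sub_left (A B C : Matrix n n ℂ) : symMul (A - B) C = symMul A C - symMul B C := by
  simp only [symMul, sub_mul, mul_sub, ← smul_sub]
  congr 1
  abel

theorem symMul_sum_left {ι : Type*} (s : Finset ι) (f : ι → Matrix n n ℂ) (C : Matrix n n ℂ) :
    symMul (∑ i ∈ s, f i) C = ∑ i ∈ s, symMul (f i) C := by
  simp only [symMul, Finset.sum_mul, Finset.mul_sum, ← Finset.sum_add_distrib, Finset.smul_sum]

theorem symMul_isHermitian {A B : Matrix n n ℂ} (hA : A.IsHermitian) (hB : B.IsHermitian) :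
    (symMul A B).IsHermitian := by
  simp only [IsHermitian, symMul, conjTranspose_smul, conjTranspose_add, conjTranspose_mul, hA.eq,
    hB.eq]
  rw [add_comm]
  simp

theorem Matrix.PosSemidef.re_trace_mul_nonneg {A B : Matrix n n ℂ} (hA : A.PosSemidef)
    (hB : B.PosSemidef) : 0 ≤ (A * B).trace.re := by
  classical
  obtain ⟨C, rfl⟩ : ∃ C : Matrix n n ℂ, A = Cᴴ * C := by
    open scoped MatrixOrder in
    exact CStarAlgebra.nonneg_iff_eq_star_mul_self.mp (Matrix.nonneg_iff_posSemidef.mpr hA)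
  rw [Matrix.mul_assoc, Matrix.trace_mul_comm]
  exact (Complex.nonneg_iff.mp (hB.mul_mul_conjTranspose_same C).trace_nonneg).1

theorem Matrix.IsHermitian.im_trace_mul {A B : Matrix n n ℂ} (hA : A.IsHermitian)
    (hB : B.IsHermitian) : (A * B).trace.im = 0 := by
  have h : star (A * B).trace = (A * B).trace := by
    rw [← trace_conjTranspose, conjTranspose_mul, hA.eq, hB.eq, trace_mul_comm]
  exact Complex.conj_eq_iff_im.mp h

/-- The Cauchy–Schwarz inequality for the form `Re Tr (ω K L)` on Hermitian matrices, by the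
discriminant of `t ↦ Tr (ω (K + t L)²)`. -/
theorem Matrix.PosSemidef.re_trace_mul_mul_le {ω K L : Matrix n n ℂ} (hω : ω.PosSemidef)
    (hK : K.IsHermitian) (hL : L.IsHermitian) :
    (symMul K ω * L).trace.re ≤ √(ω * (K * K)).trace.re * √(ω * (L * L)).trace.re := by
  have hnn (A : Matrix n n ℂ) (hA : A.IsHermitian) : 0 ≤ (ω * (A * A)).trace.re := by
    apply hω.re_trace_mul_nonneg
    have := posSemidef_conjTranspose_mul_self A
    rwa [hA.eq] at this
  have hpoly (t : ℝ) : 0 ≤ (ω * (L * L)).trace.re * (t * t) +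
      2 * (symMul K ω * L).trace.re * t + (ω * (K * K)).trace.re := by
    have h := hnn (K + (t : ℂ) • L) (hK.add (by
      simp [IsHermitian, conjTranspose_smul, hL.eq]))
    have e : (ω * ((K + (t : ℂ) • L) * (K + (t : ℂ) • L))).trace =
        (ω * (L * L)).trace * (t * t : ℝ) + 2 * (symMul K ω * L).trace * t +
          (ω * (K * K)).trace := by
      have e1 : (ω * (K * L)).trace = (ω * K * L).trace := by rw [Matrix.mul_assoc]
      have e2 : (ω * (L * K)).trace = (K * ω * L).trace := by
        rw [← Matrix.mul_assoc, trace_mul_comm, Matrix.mul_assoc]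
      simp only [symMul, add_mul, mul_add, trace_add, smul_mul, trace_smul, smul_eq_mul,
        Matrix.smul_mul, Matrix.mul_smul, e1, e2]
      push_cast
      ring
    rw [e] at h
    have e3 : (2 * (symMul K ω * L).trace * (t : ℂ)).re = 2 * (symMul K ω * L).trace.re * t := by
      rw [Complex.re_mul_ofReal]
      simp
    rw [Complex.add_re, Complex.add_re, Complex.re_mul_ofReal, e3] at h
    exact h
  have hd := discrim_le_zero hpoly
  rw [← Real.sqrt_mul (hnn K hK)]
  apply Real.le_sqrt_of_sq_le
  unfold discrim at hd
  nlinarith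

variable [DecidableEq n] {ρ : Matrix n n ℂ}

/-- The matrix entries of `O` in the eigenbasis of `ρ`, each weighted by `√(2 / (p i + p j))`, as a
Euclidean vector: its length is the Bures norm, which is thus a seminorm. -/
noncomputable def buresVec (hρ : ρ.IsHermitian) :
    Matrix n n ℂ →ₗ[ℂ] EuclideanSpace ℂ (n × n) where
  toFun O := WithLp.toLp 2 fun ij =>
    (√(2 / (hρ.eigenvalues ij.1 + hρ.eigenvalues ij.2)) : ℂ) *
      (star (hρ.eigenvectorUnitary : Matrix n n ℂ) * O *
        (hρ.eigenvectorUnitary : Matrix n n ℂ)) ij.1 ij.2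
  map_add' O P := by
    ext ij
    simp [mul_add, add_mul]
  map_smul' c O := by
    ext ij
    simp
    ring

theorem buresNorm_eq_norm (hρ : ρ.PosSemidef) (O : Matrix n n ℂ) :
    buresNorm hρ.isHermitian O = ‖buresVec hρ.isHermitian O‖ := by
  rw [EuclideanSpace.norm_eq, buresNorm, Fintype.sum_prod_type]
  congr 1
  refine Finset.sum_congr rfl fun i _ => Finset.sum_congr rfl fun j _ => ?_
  have hp := add_nonneg (hρ.eigenvalues_nonneg i) (hρ.eigenvalues_nonneg j)
  simp only [buresVec, LinearMap.coe_mk, AddHom.coe_mk, norm_mul, mul_pow, Complex.norm_real,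
    Real.norm_eq_abs, sq_abs]
  rw [Real.sq_sqrt (by positivity)]
  ring

theorem buresNorm_nonneg (hρ : ρ.IsHermitian) (O : Matrix n n ℂ) : 0 ≤ buresNorm hρ O :=
  Real.sqrt_nonneg _

/-- The reverse triangle inequality; the sign is the one in `d/dβ e^{-β H} = -H e^{-β H}`. -/
theorem abs_buresNorm_neg_add_sub_le (hρ : ρ.PosSemidef) (O P : Matrix n n ℂ) :
    |buresNorm hρ.isHermitian (-(O + P)) - buresNorm hρ.isHermitian O| ≤
      buresNorm hρ.isHermitian P := by
  simp only [buresNorm_eq_norm hρ, map_neg, norm_neg, map_add]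
  simpa using abs_norm_sub_norm_le (buresVec hρ.isHermitian O + buresVec hρ.isHermitian P)
    (buresVec hρ.isHermitian O)

theorem buresNorm_add_le (hρ : ρ.PosSemidef) (O P : Matrix n n ℂ) :
    buresNorm hρ.isHermitian (O + P) ≤
      buresNorm hρ.isHermitian O + buresNorm hρ.isHermitian P := by
  simp only [buresNorm_eq_norm hρ, map_add]
  exact norm_add_le _ _

theorem buresNorm_sum_le (hρ : ρ.PosSemidef) {ι : Type*} (s : Finset ι) (f : ι → Matrix n n ℂ) :
    buresNorm hρ.isHermitian (∑ i ∈ s, f i) ≤ ∑ i ∈ s, buresNorm hρ.isHermitian (f i) := by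
  simp only [buresNorm_eq_norm hρ, map_sum]
  exact norm_sum_le _ _

theorem Matrix.IsHermitian.star_eigenvectorUnitary_mul_self (hρ : ρ.IsHermitian) :
    star (hρ.eigenvectorUnitary : Matrix n n ℂ) * (hρ.eigenvectorUnitary : Matrix n n ℂ) = 1 :=
  Unitary.coe_star_mul_self _

theorem Matrix.IsHermitian.eigenvectorUnitary_mul_star_self (hρ : ρ.IsHermitian) :
    (hρ.eigenvectorUnitary : Matrix n n ℂ) * star (hρ.eigenvectorUnitary : Matrix n n ℂ) = 1 :=
  Unitary.coe_mul_star_self _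

theorem Matrix.IsHermitian.eq_conj_diagonal (hρ : ρ.IsHermitian) :
    ρ = (hρ.eigenvectorUnitary : Matrix n n ℂ) *
      diagonal (fun i => (hρ.eigenvalues i : ℂ)) *
        star (hρ.eigenvectorUnitary : Matrix n n ℂ) := by
  conv_lhs => rw [hρ.spectral_theorem, Unitary.conjStarAlgAut_apply]
  rfl

/-- In the eigenbasis of `ρ` the entries of `symMul K ρ` are `(p i + p j) / 2 * K i j`, so that its
squared Bures norm is the second moment of `K`. -/
theorem buresNorm_symMul_sq (hρ : ρ.PosDef) {K : Matrix n n ℂ} (hK : K.IsHermitian) :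
    buresNorm hρ.isHermitian (symMul K ρ) ^ 2 = (ρ * (K * K)).trace.re := by
  have hρ' := hρ.isHermitian
  set U := (hρ'.eigenvectorUnitary : Matrix n n ℂ) with hU
  set p := hρ'.eigenvalues with hp
  have hU1 : star U * U = 1 := hρ'.star_eigenvectorUnitary_mul_self
  have hU2 : U * star U = 1 := hρ'.eigenvectorUnitary_mul_star_self
  have hsp : ρ = U * diagonal (fun i => (p i : ℂ)) * star U := hρ'.eq_conj_diagonal
  set k := star U * K * U with hk
  have hkh (i j) : k j i = star (k i j) := by
    have : k.IsHermitian := by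
      have := isHermitian_conjTranspose_mul_mul U hK
      exact this
    exact (this.apply j i).symm
  have hpos (i) : 0 < p i := hρ.eigenvalues_pos i
  have e1 : star U * symMul K ρ * U = symMul k (diagonal fun i => (p i : ℂ)) := by
    have h1 : star U * (K * ρ) * U = k * diagonal (fun i => (p i : ℂ)) := by
      calc star U * (K * ρ) * U
          = star U * K * U * diagonal (fun i => (p i : ℂ)) * (star U * U) := by
            conv_lhs => rw [hsp]
            simp only [Matrix.mul_assoc]
        _ = _ := by rw [hU1, Matrix.mul_one]
    have h2 : star U * (ρ * K) * U = diagonal (fun i => (p i : ℂ)) * k := by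
      calc star U * (ρ * K) * U
          = (star U * U) * diagonal (fun i => (p i : ℂ)) * (star U * K * U) := by
            conv_lhs => rw [hsp]
            simp only [Matrix.mul_assoc]
        _ = _ := by rw [hU1, Matrix.one_mul]
    simp only [symMul, Matrix.mul_smul, Matrix.smul_mul, mul_add, add_mul, h1, h2]
  have e2 : (ρ * (K * K)).trace = ∑ i, ∑ j, ((p i * ‖k i j‖ ^ 2 : ℝ) : ℂ) := by
    have : ρ * (K * K) = U * (diagonal (fun i => (p i : ℂ)) * (k * k)) * star U := by
      calc ρ * (K * K) = U * diagonal (fun i => (p i : ℂ)) * star U * K * (U * star U) * K *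
          (U * star U) := by
            rw [hU2, Matrix.mul_one, Matrix.mul_one, ← hsp, Matrix.mul_assoc]
        _ = _ := by simp only [hk, Matrix.mul_assoc]
    rw [this, trace_mul_comm, ← Matrix.mul_assoc, hU1, Matrix.one_mul]
    simp only [trace, diag, diagonal_mul]
    refine Finset.sum_congr rfl fun i _ => ?_
    rw [Matrix.mul_apply, Finset.mul_sum]
    refine Finset.sum_congr rfl fun j _ => ?_
    rw [hkh i j, Complex.ofReal_mul]
    congr 1
    exact RCLike.mul_conj _ |>.trans (by simp)
  rw [buresNorm, Real.sq_sqrt (Finset.sum_nonneg fun i _ => Finset.sum_nonneg fun j _ => by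
    have := hpos i; have := hpos j; positivity), e2, ← hU, ← hp, e1]
  have e3 (i j) : 2 * ‖symMul k (diagonal fun i => (p i : ℂ)) i j‖ ^ 2 / (p i + p j) =
      (p i * ‖k i j‖ ^ 2 + p j * ‖k i j‖ ^ 2) / 2 := by
    have h : symMul k (diagonal fun i => (p i : ℂ)) i j = (((p i + p j) / 2 : ℝ) : ℂ) * k i j := by
      simp only [symMul, Matrix.smul_apply, Matrix.add_apply, diagonal_mul, mul_diagonal,
        smul_eq_mul]
      push_cast
      ring
    have := add_pos (hpos i) (hpos j)
    rw [h, norm_mul, mul_pow, Complex.norm_real, Real.norm_eq_abs, sq_abs]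
    field_simp
  simp only [e3, ← Complex.ofReal_sum, Complex.ofReal_re]
  simp only [← Finset.sum_div, Finset.sum_add_distrib]
  have e4 : ∑ i, ∑ j, p j * ‖k i j‖ ^ 2 = ∑ i, ∑ j, p i * ‖k i j‖ ^ 2 := by
    rw [Finset.sum_comm]
    refine Finset.sum_congr rfl fun i _ => Finset.sum_congr rfl fun j _ => ?_
    rw [hkh i j, norm_star]
  rw [e4]
  ring

/-- Existence of the symmetric logarithmic derivative: `L i j = 2 O i j / (p i + p j)` in the
eigenbasis of `ρ`. -/
theorem exists_symMul_eq (hρ : ρ.PosDef) {O : Matrix n n ℂ} (hO : O.IsHermitian) :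
    ∃ L : Matrix n n ℂ, L.IsHermitian ∧ symMul L ρ = O := by
  have hρ' := hρ.isHermitian
  set U := (hρ'.eigenvectorUnitary : Matrix n n ℂ) with hU
  set p := hρ'.eigenvalues with hp
  have hU1 : star U * U = 1 := hρ'.star_eigenvectorUnitary_mul_self
  have hU2 : U * star U = 1 := hρ'.eigenvectorUnitary_mul_star_self
  have hsp : ρ = U * diagonal (fun i => (p i : ℂ)) * star U := hρ'.eq_conj_diagonal
  set o := star U * O * U with ho
  have hoh : o.IsHermitian := isHermitian_conjTranspose_mul_mul U hO
  have hpos (i) : 0 < p i := hρ.eigenvalues_pos i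
  let l : Matrix n n ℂ := of fun i j => ((2 / (p i + p j) : ℝ) : ℂ) * o i j
  have hl : l.IsHermitian := by
    ext i j
    have h1 : star (o j i) = o i j := hoh.apply i j
    simp only [l, conjTranspose_apply, of_apply, star_mul', h1, add_comm (p j)]
    congr 1
    exact Complex.conj_ofReal _
  have hsym : symMul l (diagonal fun i => (p i : ℂ)) = o := by
    ext i j
    have := (add_pos (hpos i) (hpos j)).ne'
    have h' : (p i : ℂ) + p j ≠ 0 := by exact_mod_cast this
    simp only [symMul, Matrix.smul_apply, Matrix.add_apply, diagonal_mul, mul_diagonal,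
      smul_eq_mul, l, of_apply]
    push_cast
    field_simp
    ring
  refine ⟨U * l * star U, isHermitian_mul_mul_conjTranspose U hl, ?_⟩
  have h1 : U * l * star U * ρ = U * (l * diagonal fun i => (p i : ℂ)) * star U := by
    calc _ = U * l * (star U * U) * (diagonal fun i => (p i : ℂ)) * star U := by
          conv_lhs => rw [hsp]
          simp only [Matrix.mul_assoc]
      _ = _ := by rw [hU1, Matrix.mul_one, Matrix.mul_assoc U]
  have h2 : ρ * (U * l * star U) = U * ((diagonal fun i => (p i : ℂ)) * l) * star U := by
    calc _ = U * (diagonal fun i => (p i : ℂ)) * (star U * U) * l * star U := by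
          conv_lhs => rw [hsp]
          simp only [Matrix.mul_assoc]
      _ = _ := by rw [hU1, Matrix.mul_one, Matrix.mul_assoc U]
  calc symMul (U * l * star U) ρ = U * symMul l (diagonal fun i => (p i : ℂ)) * star U := by
        simp only [symMul, h1, h2, Matrix.mul_smul, Matrix.smul_mul, mul_add, add_mul]
    _ = (U * star U) * O * (U * star U) := by rw [hsym, ho]; simp only [Matrix.mul_assoc]
    _ = O := by rw [hU2, Matrix.one_mul, Matrix.mul_one]

/-- The matrix `B` is `ρ^{-1/2}`; the bound on the Bures norm is the inequality
`2 / (p i + p j) ≤ 1 / √(p i * p j)` in every entry. -/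
theorem exists_inv_sqrt (hρ : ρ.PosDef) :
    ∃ B : Matrix n n ℂ, B.IsHermitian ∧ B * ρ * B = 1 ∧ ∀ O : Matrix n n ℂ, O.IsHermitian →
      buresNorm hρ.isHermitian O ^ 2 ≤ (O * (B * O * B)).trace.re := by
  have hρ' := hρ.isHermitian
  set U := (hρ'.eigenvectorUnitary : Matrix n n ℂ) with hU
  set p := hρ'.eigenvalues with hp
  have hU1 : star U * U = 1 := hρ'.star_eigenvectorUnitary_mul_self
  have hU2 : U * star U = 1 := hρ'.eigenvectorUnitary_mul_star_self
  have hsp : ρ = U * diagonal (fun i => (p i : ℂ)) * star U := hρ'.eq_conj_diagonal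
  have hpos (i) : 0 < p i := hρ.eigenvalues_pos i
  set D : Matrix n n ℂ := diagonal fun i => (((√(p i))⁻¹ : ℝ) : ℂ) with hD
  refine ⟨U * D * star U, ?_, ?_, ?_⟩
  · refine isHermitian_mul_mul_conjTranspose U ?_
    refine isHermitian_diagonal_of_self_adjoint _ ?_
    ext i
    exact Complex.conj_ofReal _
  · calc U * D * star U * ρ * (U * D * star U)
        = U * D * (star U * U) * (diagonal fun i => (p i : ℂ)) * (star U * U) * D * star U := by
          conv_lhs => rw [hsp]
          simp only [Matrix.mul_assoc]
      _ = U * (D * (diagonal fun i => (p i : ℂ)) * D) * star U := by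
          rw [hU1]; simp only [Matrix.mul_one, Matrix.mul_assoc]
      _ = U * 1 * star U := by
          congr 2
          rw [hD, diagonal_mul_diagonal, diagonal_mul_diagonal, ← diagonal_one]
          congr 1
          ext i
          have h := Real.mul_self_sqrt (hpos i).le
          have h0 := (Real.sqrt_pos.mpr (hpos i)).ne'
          rw [← Complex.ofReal_mul, ← Complex.ofReal_mul, ← Complex.ofReal_one]
          congr 1
          nth_rewrite 2 [← h]
          field_simp
      _ = 1 := by rw [Matrix.mul_one, hU2]
  · intro O hO
    set o := star U * O * U with ho
    have hoh : o.IsHermitian := isHermitian_conjTranspose_mul_mul U hO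
    have e : O * (U * D * star U * O * (U * D * star U)) = U * (o * (D * o * D)) * star U := by
      calc _ = (U * star U) * (O * (U * D * star U * O * (U * D * star U))) := by
            rw [hU2, Matrix.one_mul]
        _ = _ := by rw [ho]; simp only [Matrix.mul_assoc]
    have e2 : (O * (U * D * star U * O * (U * D * star U))).trace =
        ∑ i, ∑ j, (((√(p i) * √(p j))⁻¹ * ‖o i j‖ ^ 2 : ℝ) : ℂ) := by
      rw [e, trace_mul_comm, ← Matrix.mul_assoc, hU1, Matrix.one_mul]
      refine Finset.sum_congr rfl fun i _ => ?_
      rw [diag_apply, Matrix.mul_apply]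
      refine Finset.sum_congr rfl fun j _ => ?_
      rw [hD, mul_diagonal, diagonal_mul]
      have h1 : o j i = star (o i j) := (hoh.apply j i).symm
      have h2 : o i j * star (o i j) = ((‖o i j‖ ^ 2 : ℝ) : ℂ) :=
        RCLike.mul_conj _ |>.trans (by simp)
      rw [h1, Complex.ofReal_mul, ← h2, mul_inv, Complex.ofReal_mul]
      ring
    rw [buresNorm, Real.sq_sqrt (Finset.sum_nonneg fun i _ => Finset.sum_nonneg fun j _ => by
      have := hpos i; have := hpos j; positivity), e2]
    simp only [← Complex.ofReal_sum, Complex.ofReal_re]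
    refine Finset.sum_le_sum fun i _ => Finset.sum_le_sum fun j _ => ?_
    have hi := Real.sqrt_pos.mpr (hpos i)
    have hj := Real.sqrt_pos.mpr (hpos j)
    have h := add_pos (hpos i) (hpos j)
    rw [mul_comm (2 : ℝ), mul_div_assoc, mul_comm]
    refine mul_le_mul_of_nonneg_right ?_ (by positivity)
    rw [inv_eq_one_div, div_le_div_iff₀ h (by positivity)]
    nlinarith [sq_nonneg (√(p i) - √(p j)), Real.mul_self_sqrt (hpos i).le,
      Real.mul_self_sqrt (hpos j).le]

open scoped Matrix.Norms.L2Operator MatrixOrder in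
theorem posSemidef_of_opNorm_le {O : Matrix n n ℂ} (hO : O.IsHermitian) {c : ℝ}
    (h : opNorm O ≤ c) : ((c : ℂ) • 1 - O).PosSemidef ∧ ((c : ℂ) • 1 + O).PosSemidef := by
  have hO' : IsSelfAdjoint O := hO
  have hn : ‖O‖ ≤ c := h
  have hc : algebraMap ℝ (Matrix n n ℂ) ‖O‖ ≤ algebraMap ℝ (Matrix n n ℂ) c :=
    algebraMap_mono _ hn
  have e : algebraMap ℝ (Matrix n n ℂ) c = (c : ℂ) • 1 := by
    rw [Algebra.algebraMap_eq_smul_one]; ext i j; simp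
  constructor
  · rw [← e]
    exact Matrix.le_iff.mp (hO'.le_algebraMap_norm_self.trans hc)
  · have h1 := (neg_le_neg hc).trans hO'.neg_algebraMap_norm_le_self
    have h2 := Matrix.le_iff.mp h1
    rwa [sub_neg_eq_add, add_comm, e] at h2

open scoped Matrix.Norms.L2Operator MatrixOrder in
theorem opNorm_le_of_posSemidef {O : Matrix n n ℂ} {c : ℝ} (hc : 0 ≤ c)
    (h1 : ((c : ℂ) • 1 - O).PosSemidef) (h2 : ((c : ℂ) • 1 + O).PosSemidef) : opNorm O ≤ c := by
  have e : algebraMap ℝ (Matrix n n ℂ) c = (c : ℂ) • 1 := by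
    rw [Algebra.algebraMap_eq_smul_one]; ext i j; simp
  have hO : IsSelfAdjoint O := by
    have h := h2.isHermitian.sub (IsSelfAdjoint.algebraMap (Matrix n n ℂ) (IsSelfAdjoint.all c))
    rwa [e, add_sub_cancel_left] at h
  have hle : O ≤ algebraMap ℝ (Matrix n n ℂ) c := by rw [e]; exact Matrix.le_iff.mpr h1
  have hge : algebraMap ℝ (Matrix n n ℂ) (-c) ≤ O := by
    rw [map_neg, e, Matrix.le_iff, sub_neg_eq_add, add_comm]; exact h2
  have hle' := (le_algebraMap_iff_spectrum_le hO).mp hle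
  have hge' := (algebraMap_le_iff_le_spectrum hO).mp hge
  change ‖O‖ ≤ c
  rw [← cfc_id ℝ O]
  exact norm_cfc_le hc fun x hx => abs_le.mpr ⟨hge' x hx, hle' x hx⟩

end BuresNorm

/-! ### Operators on subsystems and the partial trace -/

section Subsystems

open Matrix
open scoped ComplexOrder Kronecker

theorem splitSites_apply_snd {V : Type*} [DecidableEq V] {σ : V → Type*} (X : Finset V)
    (s : ∀ x, σ x) (x : {x // x ∉ X}) :
    (splitSites σ X s).2 x = s x := rfl

variable {V : Type*} [Fintype V] [DecidableEq V] {σ : V → Type*}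

section PartialTrace

variable [∀ x, Fintype (σ x)]

theorem partialTrace_eq_sum (A : Finset V) (O : GlobalOp σ) :
    partialTrace A O = ∑ b : ∀ x : {x // x ∉ A}, σ x,
      O.submatrix (fun a => (splitSites σ A).symm (a, b))
        (fun a => (splitSites σ A).symm (a, b)) := by
  ext a a'
  simp [partialTrace, Matrix.sum_apply]

theorem partialTrace_add (A : Finset V) (O P : GlobalOp σ) :
    partialTrace A (O + P) = partialTrace A O + partialTrace A P := by
  ext a a'
  simp [partialTrace, Finset.sum_add_distrib]

theorem partialTrace_sub (A : Finset V) (O P : GlobalOp σ) :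
    partialTrace A (O - P) = partialTrace A O - partialTrace A P := by
  ext a a'
  simp [partialTrace, Finset.sum_sub_distrib]

theorem partialTrace_smul (A : Finset V) (c : ℂ) (O : GlobalOp σ) :
    partialTrace A (c • O) = c • partialTrace A O := by
  ext a a'
  simp [partialTrace, Finset.mul_sum]

theorem partialTrace_sum (A : Finset V) {ι : Type*} (s : Finset ι) (f : ι → GlobalOp σ) :
    partialTrace A (∑ i ∈ s, f i) = ∑ i ∈ s, partialTrace A (f i) := by
  ext a a'
  simp only [partialTrace, of_apply, Matrix.sum_apply]
  exact Finset.sum_comm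

theorem trace_partialTrace (A : Finset V) (O : GlobalOp σ) :
    (partialTrace A O).trace = O.trace := by
  simp only [trace, diag, partialTrace, of_apply]
  rw [← Fintype.sum_prod_type', ← (splitSites σ A).symm.sum_comp]

/-- The partial trace of a positive definite operator is positive definite. The complement of `A`
must have a configuration, hence the sites have nonzero Hilbert spaces. -/
theorem Matrix.PosDef.partialTrace [∀ x, Nonempty (σ x)] (A : Finset V) {ω : GlobalOp σ}
    (hω : ω.PosDef) : (partialTrace A ω).PosDef := by
  rw [partialTrace_eq_sum]
  refine posDef_sum Finset.univ_nonempty fun b _ => hω.submatrix fun a a' h => ?_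
  simpa using h

end PartialTrace

variable [∀ x, DecidableEq (σ x)]

theorem embedOp_apply (X : Finset V) (O : LocalOp σ X) (s t : ∀ x, σ x) :
    embedOp X O s t = if ∀ x, x ∉ X → s x = t x then
      O (splitSites σ X s).1 (splitSites σ X t).1 else 0 := by
  have h : (splitSites σ X s).2 = (splitSites σ X t).2 ↔ ∀ x, x ∉ X → s x = t x := by
    simp [funext_iff, splitSites_apply_snd]
  simp [embedOp, Matrix.one_apply, h]

theorem SupportedIn.mono {X A : Finset V} (hXA : X ⊆ A) {O : GlobalOp σ} (hO : SupportedIn X O) :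
    SupportedIn A O := by
  obtain ⟨O', rfl⟩ := hO
  refine ⟨of fun a a' => if ∀ x : {x // x ∈ A}, (x : V) ∉ X → a x = a' x then
    O' (fun x => a ⟨x, hXA x.2⟩) (fun x => a' ⟨x, hXA x.2⟩) else 0, ?_⟩
  ext s t
  rw [embedOp_apply, embedOp_apply]
  refine Eq.trans (if_congr ⟨fun h => ⟨fun x hx => h x fun hx' => hx (hXA hx'),
    fun x hx => h x hx⟩, fun h x hx => ?_⟩ rfl rfl) (ite_and _ _ _ _)
  by_cases hxA : x ∈ A
  · exact h.2 ⟨x, hxA⟩ hx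
  · exact h.1 x hxA

/-- An operator supported away from `X` acts as the identity on the tensor factor of `X`. -/
theorem SupportedIn.exists_eq_one_kronecker {X Y : Finset V} (hXY : Disjoint Y X) {O : GlobalOp σ}
    (hO : SupportedIn Y O) :
    ∃ Q : Matrix (∀ x : {x // x ∉ X}, σ x) (∀ x : {x // x ∉ X}, σ x) ℂ,
      O = ((1 : LocalOp σ X) ⊗ₖ Q).submatrix (splitSites σ X) (splitSites σ X) := by
  obtain ⟨O', rfl⟩ := hO
  have hsub {x : V} (hx : x ∈ Y) : x ∉ X := fun h => Finset.disjoint_left.mp hXY hx h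
  refine ⟨of fun b b' => if ∀ x : {x // x ∉ X}, (x : V) ∉ Y → b x = b' x then
    O' (fun x => b ⟨x, hsub x.2⟩) (fun x => b' ⟨x, hsub x.2⟩) else 0, ?_⟩
  ext s t
  rw [embedOp_apply, submatrix_apply, kroneckerMap_apply, Matrix.one_apply, ite_mul, one_mul,
    zero_mul]
  refine Eq.trans (if_congr ⟨fun h => ⟨funext fun x => h x fun hx' => hsub hx' x.2,
    fun x hx => h x hx⟩, fun h x hx => ?_⟩ rfl rfl) (ite_and _ _ _ _)
  by_cases hxX : x ∈ X
  · exact congrFun h.1 ⟨x, hxX⟩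
  · exact h.2 ⟨x, hxX⟩ hx

theorem embedOp_one (X : Finset V) : embedOp X (1 : LocalOp σ X) = 1 := by
  rw [embedOp, one_kronecker_one, submatrix_one_equiv]

theorem embedOp_add (X : Finset V) (O P : LocalOp σ X) :
    embedOp X (O + P) = embedOp X O + embedOp X P := by
  rw [embedOp, add_kronecker]; rfl

theorem embedOp_smul (X : Finset V) (c : ℂ) (O : LocalOp σ X) :
    embedOp X (c • O) = c • embedOp X O := by
  rw [embedOp, smul_kronecker]; rfl

theorem embedOp_sub (X : Finset V) (O P : LocalOp σ X) :
    embedOp X (O - P) = embedOp X O - embedOp X P := by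
  rw [sub_eq_add_neg, sub_eq_add_neg, embedOp_add, ← neg_one_smul ℂ P, embedOp_smul, neg_one_smul]

theorem conjTranspose_embedOp (X : Finset V) (O : LocalOp σ X) :
    (embedOp X O)ᴴ = embedOp X Oᴴ := by
  rw [embedOp, conjTranspose_submatrix, conjTranspose_kronecker, conjTranspose_one, embedOp]

theorem Matrix.IsHermitian.embedOp {X : Finset V} {O : LocalOp σ X} (hO : O.IsHermitian) :
    (embedOp X O).IsHermitian := by
  rw [IsHermitian, conjTranspose_embedOp, hO.eq]

theorem SupportedIn.exists_isHermitian {X : Finset V} {O : GlobalOp σ} (hO : SupportedIn X O)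
    (hOh : O.IsHermitian) : ∃ k : LocalOp σ X, k.IsHermitian ∧ O = embedOp X k := by
  obtain ⟨k, rfl⟩ := hO
  refine ⟨(1 / 2 : ℂ) • (k + kᴴ), ?_, ?_⟩
  · rw [IsHermitian, conjTranspose_smul, conjTranspose_add, conjTranspose_conjTranspose, add_comm]
    simp
  · rw [embedOp_smul, embedOp_add, ← conjTranspose_embedOp, hOh.eq]
    module

theorem SupportedIn.sub_smul_one {X : Finset V} {O : GlobalOp σ} (hO : SupportedIn X O) (c : ℂ) :
    SupportedIn X (O - c • 1) := by
  obtain ⟨O', rfl⟩ := hO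
  exact ⟨O' - c • 1, by rw [embedOp_sub, embedOp_smul, embedOp_one]⟩

theorem supportedIn_sum (X : Finset V) {ι : Type*} (s : Finset ι) (f : ι → GlobalOp σ)
    (hf : ∀ i ∈ s, SupportedIn X (f i)) : SupportedIn X (∑ i ∈ s, f i) := by
  refine Finset.sum_induction f (SupportedIn X) ?_ ⟨0, ?_⟩ hf
  · rintro _ _ ⟨O, rfl⟩ ⟨P, rfl⟩
    exact ⟨O + P, (embedOp_add X O P).symm⟩
  · simpa using (embedOp_smul X 0 (0 : LocalOp σ X)).symm

variable [∀ x, Fintype (σ x)]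

theorem embedOp_mul (X : Finset V) (O P : LocalOp σ X) :
    embedOp X (O * P) = embedOp X O * embedOp X P := by
  rw [embedOp, embedOp, embedOp, submatrix_mul_equiv, ← mul_kronecker_mul, Matrix.one_mul]

theorem Matrix.PosSemidef.embedOp {X : Finset V} {O : LocalOp σ X} (hO : O.PosSemidef) :
    (embedOp X O).PosSemidef :=
  (hO.kronecker PosSemidef.one).submatrix _

theorem SupportedIn.commute_embedOp {X A : Finset V} (hXA : Disjoint X A) {P : GlobalOp σ}
    (hP : SupportedIn X P) (O : LocalOp σ A) : Commute (embedOp A O) P := by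
  obtain ⟨Q, rfl⟩ := hP.exists_eq_one_kronecker hXA
  rw [Commute, SemiconjBy, embedOp, submatrix_mul_equiv, submatrix_mul_equiv, ← mul_kronecker_mul,
    ← mul_kronecker_mul, Matrix.one_mul, Matrix.mul_one, Matrix.one_mul, Matrix.mul_one]

/-- The partial trace is a homomorphism of left modules over the operators on `A`. -/
theorem partialTrace_embedOp_mul (A : Finset V) (L : LocalOp σ A) (O : GlobalOp σ) :
    partialTrace A (embedOp A L * O) = L * partialTrace A O := by
  ext a a'
  simp only [partialTrace, of_apply, Matrix.mul_apply, Finset.mul_sum, embedOp,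
    submatrix_apply]
  rw [Finset.sum_comm]
  conv_rhs => rw [← Fintype.sum_prod_type']
  rw [← (splitSites σ A).symm.sum_comp]
  refine Finset.sum_congr rfl fun c _ => ?_
  simp [Matrix.one_apply]

theorem partialTrace_mul_embedOp (A : Finset V) (L : LocalOp σ A) (O : GlobalOp σ) :
    partialTrace A (O * embedOp A L) = partialTrace A O * L := by
  ext a a'
  simp only [partialTrace, of_apply, Matrix.mul_apply, Finset.sum_mul, embedOp,
    submatrix_apply]
  rw [Finset.sum_comm]
  conv_rhs => rw [← Fintype.sum_prod_type']
  rw [← (splitSites σ A).symm.sum_comp]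
  refine Finset.sum_congr rfl fun c _ => ?_
  simp [Matrix.one_apply]

theorem trace_mul_partialTrace (A : Finset V) (L : LocalOp σ A) (O : GlobalOp σ) :
    (L * partialTrace A O).trace = (embedOp A L * O).trace := by
  rw [← partialTrace_embedOp_mul, trace_partialTrace]

theorem trace_partialTrace_mul (A : Finset V) (L : LocalOp σ A) (O : GlobalOp σ) :
    (partialTrace A O * L).trace = (O * embedOp A L).trace := by
  rw [← partialTrace_mul_embedOp, trace_partialTrace]

theorem partialTrace_symMul_embedOp (A : Finset V) (k : LocalOp σ A) (ω : GlobalOp σ) :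
    partialTrace A (symMul (embedOp A k) ω) = symMul k (partialTrace A ω) := by
  rw [symMul, partialTrace_smul, partialTrace_add, partialTrace_embedOp_mul,
    partialTrace_mul_embedOp, symMul]

/-- The map `P ↦ Tr_{Aᶜ} (symMul P ω)` is positive on operators supported away from `A`, as these
commute with the operators on `A`. Without the condition on the support it is not positive in
general. -/
theorem posSemidef_partialTrace_symMul {X A : Finset V} (hXA : Disjoint X A) {ω P : GlobalOp σ}
    (hω : ω.PosSemidef) (hP : P.PosSemidef) (hPX : SupportedIn X P) :
    (partialTrace A (symMul P ω)).PosSemidef := by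
  have hH := partialTrace_isHermitian A (symMul_isHermitian hP.isHermitian hω.isHermitian)
  refine PosSemidef.of_dotProduct_mulVec_nonneg hH fun v => ?_
  set T := partialTrace A (symMul P ω) with hT
  have e1 : star v ⬝ᵥ (T *ᵥ v) = (vecMulVec v (star v) * T).trace := by
    rw [vecMulVec_mul, trace_vecMulVec, dotProduct_mulVec, dotProduct_comm]
  set W := vecMulVec v (star v) with hW
  have hWp : W.PosSemidef := posSemidef_vecMulVec_self_star v
  have hcomm := hPX.commute_embedOp hXA W
  set E := embedOp A W with hE
  have hEh : E.IsHermitian := hWp.isHermitian.embedOp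
  have e2 : (W * T).trace.re = (E * P * ω).trace.re := by
    have e3 : (E * (ω * P)).trace = star (E * P * ω).trace := by
      rw [← trace_conjTranspose, conjTranspose_mul, conjTranspose_mul, hω.isHermitian.eq,
        hP.isHermitian.eq, hEh.eq, trace_mul_comm, Matrix.mul_assoc]
    rw [hT, trace_mul_partialTrace, symMul, Matrix.mul_smul, trace_smul, mul_add, trace_add, e3,
      ← Matrix.mul_assoc]
    simp
    ring
  have him : (W * T).trace.im = 0 := hWp.isHermitian.im_trace_mul hH
  rw [e1, Complex.nonneg_iff, him]
  refine ⟨?_, rfl⟩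
  rw [e2]
  rcases eq_or_ne v 0 with rfl | hv
  · simp [hE, hW, embedOp]
  have hc : 0 < star v ⬝ᵥ v := dotProduct_star_self_pos_iff.mpr hv
  obtain ⟨hc1, hc2⟩ := Complex.pos_iff.mp hc
  have hc3 : star v ⬝ᵥ v = ((star v ⬝ᵥ v).re : ℂ) := Complex.ext rfl (by simp [← hc2])
  -- `E` is a multiple of a projection that commutes with `P`, so `Tr (E P ω)` is a multiple of
  -- `Tr (E P E ω)`, a trace of a product of positive operators.
  have hEE : E * E = ((star v ⬝ᵥ v).re : ℂ) • E := by
    rw [hE, ← embedOp_mul, hW, vecMulVec_mul_vecMulVec, ← embedOp_smul, ← hc3]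
    congr 1
    ext i j
    simp [vecMulVec_apply]
    ring
  have hEPE : (E * P * E).PosSemidef := by
    have := hP.mul_mul_conjTranspose_same E
    rwa [hEh.eq] at this
  have h := hEPE.re_trace_mul_nonneg hω
  rw [Matrix.mul_assoc E, ← hcomm.eq, ← Matrix.mul_assoc, hEE, Matrix.smul_mul, Matrix.smul_mul,
    trace_smul, smul_eq_mul, Complex.re_ofReal_mul] at h
  exact nonneg_of_mul_nonneg_right h hc1

variable [∀ x, Nonempty (σ x)]

theorem buresNorm_partialTrace_embedOp (A : Finset V) {ω : GlobalOp σ} (hω : ω.PosDef)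
    {k : LocalOp σ A} (hk : k.IsHermitian) :
    buresNorm (partialTrace_isHermitian A hω.isHermitian)
        (partialTrace A (symMul (embedOp A k) ω)) =
      √(ω * (embedOp A k * embedOp A k)).trace.re := by
  rw [partialTrace_symMul_embedOp, ← Real.sqrt_sq (buresNorm_nonneg _ _),
    buresNorm_symMul_sq (hω.partialTrace A) hk, trace_partialTrace_mul, embedOp_mul]

/-- The Bures norm does not increase under the partial trace. -/
theorem buresNorm_partialTrace_le (A : Finset V) {ω : GlobalOp σ} (hω : ω.PosDef)
    {K : GlobalOp σ} (hK : K.IsHermitian) :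
    buresNorm (partialTrace_isHermitian A hω.isHermitian) (partialTrace A (symMul K ω)) ≤
      √(ω * (K * K)).trace.re := by
  have hρ := hω.partialTrace A
  -- For the symmetric logarithmic derivative `L` of the partial trace, both `Tr (ω (L ⊗ 𝟙)²)` and
  -- `Re Tr (symMul K ω * (L ⊗ 𝟙))` are equal to `B ^ 2`.
  obtain ⟨L, hL, hLO⟩ := exists_symMul_eq hρ
    (partialTrace_isHermitian A (symMul_isHermitian hK hω.isHermitian))
  set B := buresNorm hρ.isHermitian (partialTrace A (symMul K ω)) with hB
  have h1 : B ^ 2 = (ω * (embedOp A L * embedOp A L)).trace.re := by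
    rw [hB, ← hLO, buresNorm_symMul_sq hρ hL, trace_partialTrace_mul, embedOp_mul]
  have h2 : B ^ 2 = (symMul K ω * embedOp A L).trace.re := by
    rw [← trace_partialTrace_mul, ← hLO, h1, ← embedOp_mul, ← trace_partialTrace_mul]
    congr 1
    rw [symMul, Matrix.smul_mul, trace_smul, add_mul, trace_add, Matrix.mul_assoc, Matrix.mul_assoc,
      trace_mul_comm L, Matrix.mul_assoc, smul_eq_mul]
    ring
  have h3 := hω.posSemidef.re_trace_mul_mul_le hK hL.embedOp
  have hB0 : 0 ≤ B := buresNorm_nonneg _ _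
  rw [← h2, ← h1, Real.sqrt_sq hB0] at h3
  change B ≤ _
  rcases hB0.eq_or_lt with h | h
  · rw [← h]; exact Real.sqrt_nonneg _
  · exact le_of_mul_le_mul_right (by rwa [pow_two] at h3) h

/-- The squared Bures norm of the response of the reduced state to `P`, supported away from `A`, is
bounded by the correlation of `P` with an observable `K` on `A` that is no larger than `P`, namely
`K = ρ^{-1/2} T ρ^{-1/2}` with `T = Tr_{Aᶜ} (symMul P ω)`. -/
theorem exists_opNorm_le_buresNorm_sq_le {X A : Finset V} (hXA : Disjoint X A) {ω P : GlobalOp σ}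
    (hω : ω.PosDef) (hω1 : ω.trace = 1) (hP : P.IsHermitian) (hPX : SupportedIn X P) {J : ℝ}
    (hJ0 : 0 ≤ J) (hJ : opNorm P ≤ J) :
    ∃ K : LocalOp σ A, K.IsHermitian ∧ opNorm (embedOp A K) ≤ J ∧
      buresNorm (partialTrace_isHermitian A hω.isHermitian)
          (partialTrace A (symMul (P - (P * ω).trace • 1) ω)) ^ 2 ≤
        ‖(P * embedOp A K * ω).trace - (P * ω).trace * (embedOp A K * ω).trace‖ := by
  have hρ := hω.partialTrace A
  set ρ := partialTrace A ω with hρdef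
  obtain ⟨B, hB, hBρ, hbound⟩ := exists_inv_sqrt hρ
  set c := (P * ω).trace with hc
  have hcre : star c = c := Complex.conj_eq_iff_im.mpr (hP.im_trace_mul hω.isHermitian)
  set T := partialTrace A (symMul P ω) with hT
  have hTh : T.IsHermitian := partialTrace_isHermitian A (symMul_isHermitian hP hω.isHermitian)
  have hsym1 (z : ℂ) : symMul (z • 1) ω = z • ω := by
    ext i j
    simp [symMul]
    ring
  have hO : partialTrace A (symMul (P - c • 1) ω) = T - c • ρ := by
    rw [symMul_sub_left, hsym1, partialTrace_sub, partialTrace_smul]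
  have hOh : (T - c • ρ).IsHermitian := by
    rw [IsHermitian, conjTranspose_sub, conjTranspose_smul, hTh.eq, hρ.isHermitian.eq, hcre]
  -- Conjugation by `ρ^{-1/2}` turns `-J ρ ≤ T ≤ J ρ` into `-J ≤ K ≤ J`.
  have hconj {Q : LocalOp σ A} (hQ : Q.PosSemidef) : (B * Q * B).PosSemidef := by
    have := hQ.mul_mul_conjTranspose_same B
    rwa [hB.eq] at this
  obtain ⟨hm, hp⟩ := posSemidef_of_opNorm_le hP hJ
  have hKm : ((J : ℂ) • 1 - B * T * B).PosSemidef := by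
    have h := hconj (posSemidef_partialTrace_symMul hXA hω.posSemidef hm (by
      obtain ⟨P', rfl⟩ := hPX
      exact ⟨(J : ℂ) • 1 - P', by rw [embedOp_sub, embedOp_smul, embedOp_one]⟩))
    rwa [symMul_sub_left, hsym1, partialTrace_sub, partialTrace_smul, mul_sub, sub_mul,
      Matrix.mul_smul, Matrix.smul_mul, hBρ] at h
  have hKp : ((J : ℂ) • 1 + B * T * B).PosSemidef := by
    have h := hconj (posSemidef_partialTrace_symMul hXA hω.posSemidef hp (by
      obtain ⟨P', rfl⟩ := hPX
      exact ⟨(J : ℂ) • 1 + P', by rw [embedOp_add, embedOp_smul, embedOp_one]⟩))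
    rwa [symMul_add_left, hsym1, partialTrace_add, partialTrace_smul, mul_add, add_mul,
      Matrix.mul_smul, Matrix.smul_mul, hBρ] at h
  have hKh : (B * T * B).IsHermitian := by
    have := isHermitian_mul_mul_conjTranspose B hTh
    rwa [hB.eq] at this
  set K := B * T * B with hK
  refine ⟨K, hKh, opNorm_le_of_posSemidef hJ0 ?_ ?_, ?_⟩
  · rw [← embedOp_one A, ← embedOp_smul, ← embedOp_sub]
    exact hKm.embedOp
  · rw [← embedOp_one A, ← embedOp_smul, ← embedOp_add]
    exact hKp.embedOp
  · rw [hO]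
    have hcomm := hPX.commute_embedOp hXA K
    have e1 : B * (T - c • ρ) * B = K - c • 1 := by
      rw [mul_sub, sub_mul, Matrix.mul_smul, Matrix.smul_mul, hBρ]
    have e2 : (T * K).trace = (P * embedOp A K * ω).trace := by
      have e3 : (ω * P * embedOp A K).trace = (P * embedOp A K * ω).trace := by
        rw [Matrix.mul_assoc, trace_mul_comm]
      have e4 : (P * ω * embedOp A K).trace = (P * embedOp A K * ω).trace := by
        rw [trace_mul_comm, ← Matrix.mul_assoc, hcomm.eq]
      rw [hT, trace_partialTrace_mul, symMul, Matrix.smul_mul, trace_smul, add_mul, trace_add, e3,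
        e4, smul_eq_mul]
      ring
    have e5 : (ρ * K).trace = (embedOp A K * ω).trace := by
      rw [trace_mul_comm, trace_mul_partialTrace]
    have e6 : T.trace = c := by
      rw [hT, trace_partialTrace, symMul, trace_smul, trace_add, trace_mul_comm ω P, smul_eq_mul]
      ring
    have e7 : ρ.trace = 1 := by rw [hρdef, trace_partialTrace, hω1]
    have e8 : ((T - c • ρ) * (B * (T - c • ρ) * B)).trace =
        (P * embedOp A K * ω).trace - c * (embedOp A K * ω).trace := by
      rw [e1]
      simp only [sub_mul, mul_sub, trace_sub, Matrix.smul_mul, Matrix.mul_smul, Matrix.mul_one,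
        trace_smul, e2, e5, e6, e7, smul_eq_mul]
      ring
    rw [← e8]
    exact (hbound _ hOh).trans (Complex.re_le_norm _)

end Subsystems

/-! ### The Gibbs state and its derivative -/

section Thermal

open Matrix
open scoped ComplexOrder

variable {V : Type*} [Fintype V] [DecidableEq V] {σ : V → Type*} [∀ x, DecidableEq (σ x)]

namespace LatticeSystem

theorem ham_isHermitian (S : LatticeSystem V σ) {G : Finset (Finset V)} (hG : G ⊆ S.edges) :
    (S.ham G).IsHermitian := by
  rw [ham, IsHermitian, conjTranspose_sum]
  exact Finset.sum_congr rfl fun X hX => S.isHermitian_term X (hG hX)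

variable [∀ x, Fintype (σ x)]

theorem gibbsWeight_posDef (S : LatticeSystem V σ) (β : ℝ) : (S.gibbsWeight β).PosDef := by
  -- `B` is the positive square root of the Gibbs operator.
  set B : GlobalOp σ := NormedSpace.exp ((-β / 2) • S.ham S.edges) with hB
  have hBh : B.IsHermitian := by
    refine IsHermitian.exp ?_
    rw [IsHermitian, conjTranspose_smul, S.ham_edges_isHermitian.eq, star_trivial]
  have e : S.gibbsWeight β = Bᴴ * B := by
    rw [hBh.eq, hB, ← exp_add_of_commute _ _ (Commute.refl _), ← add_smul, add_halves, gibbsWeight]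
  rw [e]
  exact PosDef.conjTranspose_mul_self B (mulVec_injective_of_isUnit (isUnit_exp _))

/-- The observable `O - ⟨O⟩_β`, of mean zero in the Gibbs state. -/
noncomputable def centered (S : LatticeSystem V σ) (β : ℝ) (O : GlobalOp σ) : GlobalOp σ :=
  O - S.expect β O • 1

theorem expect_sum (S : LatticeSystem V σ) (β : ℝ) {ι : Type*} (s : Finset ι)
    (f : ι → GlobalOp σ) : S.expect β (∑ i ∈ s, f i) = ∑ i ∈ s, S.expect β (f i) := by
  simp only [expect, Finset.sum_mul, trace_sum]

theorem centered_sum (S : LatticeSystem V σ) (β : ℝ) {ι : Type*} (s : Finset ι)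
    (f : ι → GlobalOp σ) : S.centered β (∑ i ∈ s, f i) = ∑ i ∈ s, S.centered β (f i) := by
  simp only [centered, Finset.sum_sub_distrib, expect_sum, Finset.sum_smul]

theorem centered_isHermitian (S : LatticeSystem V σ) (β : ℝ) {O : GlobalOp σ}
    (hO : O.IsHermitian) : (S.centered β O).IsHermitian := by
  have h : star (S.expect β O) = S.expect β O :=
    Complex.conj_eq_iff_im.mpr (hO.im_trace_mul (S.gibbs_isHermitian β))
  rw [centered, IsHermitian, conjTranspose_sub, conjTranspose_smul, conjTranspose_one, hO.eq, h]

variable [∀ x, Nonempty (σ x)]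

theorem trace_gibbsWeight_pos (S : LatticeSystem V σ) (β : ℝ) : 0 < (S.gibbsWeight β).trace :=
  (S.gibbsWeight_posDef β).trace_pos

theorem gibbs_posDef (S : LatticeSystem V σ) (β : ℝ) : (S.gibbs β).PosDef :=
  (S.gibbsWeight_posDef β).smul (RCLike.inv_pos.mpr (S.trace_gibbsWeight_pos β))

theorem trace_gibbs (S : LatticeSystem V σ) (β : ℝ) : (S.gibbs β).trace = 1 := by
  rw [gibbs, trace_smul, smul_eq_mul, inv_mul_cancel₀ (S.trace_gibbsWeight_pos β).ne']

theorem variance_eq_centered (S : LatticeSystem V σ) (β : ℝ) (O : GlobalOp σ) :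
    S.variance β O = (S.gibbs β * (S.centered β O * S.centered β O)).trace.re := by
  rw [variance]
  congr 1
  have h : (O * S.gibbs β).trace = S.expect β O := rfl
  rw [trace_mul_comm]
  simp only [centered, sub_mul, mul_sub, trace_sub, Matrix.smul_mul, Matrix.mul_smul,
    Matrix.mul_one, Matrix.one_mul, trace_smul, h, S.trace_gibbs β, smul_eq_mul]
  rw [expect]
  ring

open scoped Matrix.Norms.L2Operator in
/-- The Gibbs state satisfies `dω/dβ = -symMul (H - ⟨H⟩) ω`, since `H` commutes with `ω`. The
derivative is stated through linear functionals, which keeps a choice of matrix norm out of it. -/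
theorem hasDerivAt_apply_gibbs (S : LatticeSystem V σ) (f : GlobalOp σ →ₗ[ℝ] ℂ) (β : ℝ) :
    HasDerivAt (fun b => f (S.gibbs b))
      (f (-symMul (S.centered β (S.ham S.edges)) (S.gibbs β))) β := by
  set H := S.ham S.edges with hH
  have hW : HasDerivAt S.gibbsWeight (-(S.gibbsWeight β * H)) β := by
    have h1 := hasDerivAt_exp_smul_const (𝕂 := ℝ) H (-β)
    have h2 := h1.scomp β (hasDerivAt_neg β)
    rw [neg_one_smul] at h2
    exact h2
  have hcomm : Commute (S.gibbsWeight β) H := by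
    have h : Commute (-β • H) H := (Commute.refl H).smul_left _
    exact h.exp_left
  have hZ : HasDerivAt (fun b => (S.gibbsWeight b).trace) (-(S.gibbsWeight β * H)).trace β :=
    (LinearMap.toContinuousLinearMap (traceLinearMap (∀ x, σ x) ℝ ℂ)).hasFDerivAt.comp_hasDerivAt
      β hW
  have hZ0 : (S.gibbsWeight β).trace ≠ 0 := (S.trace_gibbsWeight_pos β).ne'
  have hω := (hZ.inv hZ0).smul hW
  have e : (S.gibbsWeight β).trace⁻¹ • -(S.gibbsWeight β * H) +
      (-(-(S.gibbsWeight β * H)).trace / (S.gibbsWeight β).trace ^ 2) • S.gibbsWeight β =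
      -symMul (S.centered β H) (S.gibbs β) := by
    have h1 : (S.gibbsWeight β * H).trace = S.expect β H * (S.gibbsWeight β).trace := by
      rw [expect, gibbs, Matrix.mul_smul, trace_smul, trace_mul_comm, smul_eq_mul]
      field_simp
    have h2 : symMul (S.centered β H) (S.gibbs β) =
        (S.gibbsWeight β).trace⁻¹ • (S.gibbsWeight β * H) - S.expect β H • S.gibbs β := by
      simp only [symMul, centered, gibbs, sub_mul, mul_sub, Matrix.mul_smul, Matrix.smul_mul,
        Matrix.one_mul, Matrix.mul_one, ← hcomm.eq]
      module
    rw [h2, trace_neg, h1, neg_neg, gibbs, smul_smul, smul_neg, neg_sub, sub_eq_add_neg, add_comm]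
    congr 2
    field_simp
  have hω' : HasDerivAt S.gibbs (-symMul (S.centered β H) (S.gibbs β)) β := by
    rw [← e]
    exact hω
  exact (LinearMap.toContinuousLinearMap f).hasFDerivAt.comp_hasDerivAt β hω'

theorem reducedDeriv_eq (S : LatticeSystem V σ) (A : Finset V) (β : ℝ) :
    S.reducedDeriv A β =
      -partialTrace A (symMul (S.centered β (S.ham S.edges)) (S.gibbs β)) := by
  ext a a'
  let f : GlobalOp σ →ₗ[ℝ] ℂ :=
    { toFun := fun O => partialTrace A O a a'
      map_add' := fun O P => by rw [partialTrace_add]; rfl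
      map_smul' := fun c O => by
        have : c • O = (c : ℂ) • O := by ext; simp
        rw [this, partialTrace_smul]; simp }
  have h := (S.hasDerivAt_apply_gibbs f β).deriv
  rw [map_neg] at h
  exact h

end LatticeSystem

end Thermal

/-! ### Distances and summation of the decay -/

section Geometry

variable {V : Type*} [Fintype V] [DecidableEq V] {σ : V → Type*} [∀ x, DecidableEq (σ x)]

namespace LatticeSystem

theorem IsEdgePath.reverse {S : LatticeSystem V σ} {x y : V} {L : List (Finset V)}
    (h : S.IsEdgePath x y L) : S.IsEdgePath y x L.reverse := by
  obtain ⟨h1, h2, h3, h4⟩ := h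
  refine ⟨by simpa using h1, ?_, by simpa using h4, by simpa using h3⟩
  rw [List.isChain_reverse]
  simpa only [Finset.inter_comm] using h2

theorem siteDist_comm (S : LatticeSystem V σ) (x y : V) : S.siteDist x y = S.siteDist y x := by
  have key (x y : V) : (⨅ (L : List (Finset V)) (_ : S.IsEdgePath x y L), (L.length : ℕ∞)) ≤
      ⨅ (L : List (Finset V)) (_ : S.IsEdgePath y x L), (L.length : ℕ∞) :=
    le_iInf₂ fun L hL => (iInf₂_le L.reverse hL.reverse).trans (by simp)
  unfold siteDist
  simp only [eq_comm (a := y) (b := x)]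
  split_ifs
  · rfl
  · exact le_antisymm (key x y) (key y x)

theorem setDist_eq (S : LatticeSystem V σ) (X A : Finset V) :
    S.setDist X A = ⨅ a ∈ A, S.distTo a X := by
  simp only [setDist, distTo]
  rw [iInf₂_comm]
  simp only [S.siteDist_comm]

theorem setDist_le_distTo (S : LatticeSystem V σ) {X A : Finset V} {a : V} (ha : a ∈ A) :
    S.setDist X A ≤ S.distTo a X := by
  rw [setDist_eq]
  exact iInf₂_le a ha

/-- A finite distance of two sets is attained. -/
theorem exists_distTo_eq_setDist (S : LatticeSystem V σ) {X A : Finset V}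
    (h : S.setDist X A ≠ ⊤) : ∃ a ∈ A, S.distTo a X = S.setDist X A := by
  have hA : A.Nonempty := by
    rw [Finset.nonempty_iff_ne_empty]
    rintro rfl
    exact h (by simp [setDist_eq])
  obtain ⟨a, ha, hmin⟩ := A.exists_min_image (fun a => S.distTo a X) hA
  refine ⟨a, ha, le_antisymm ?_ (S.setDist_le_distTo ha)⟩
  rw [setDist_eq]
  exact le_iInf₂ hmin

theorem disjoint_of_setDist_ne_zero (S : LatticeSystem V σ) {X A : Finset V}
    (h : S.setDist X A ≠ 0) : Disjoint X A := by
  rw [Finset.disjoint_left]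
  intro x hx hA
  refine h (le_antisymm ?_ zero_le)
  refine (iInf₂_le x hx).trans ((iInf₂_le x hA).trans ?_)
  simp [siteDist]

theorem decay_nonneg (ξ : ℝ) (d : ℕ∞) : 0 ≤ decay ξ d := by
  unfold decay
  split_ifs <;> positivity

theorem sqrt_decay (ξ : ℝ) (d : ℕ∞) : √(decay ξ d) = decay (2 * ξ) d := by
  unfold decay
  split_ifs
  · simp
  · rw [← Real.exp_half, mul_comm 2 ξ, div_div]

/-- A tail bound for `∑ (n + 1)² q ^ n`, in terms of `s = 1 / (1 - q)`. -/
theorem sum_Ico_sq_mul_pow_le {R : ℕ} {s : ℝ} (hs : 1 ≤ s) (hsR : s ≤ R) (N : ℕ) :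
    ∑ n ∈ Finset.Ico R N, ((n : ℝ) + 1) ^ 2 * (1 - 1 / s) ^ n ≤
      5 * s * R ^ 2 * (1 - 1 / s) ^ R := by
  have hs0 : 0 < s := by linarith
  set q := 1 - 1 / s with hq
  have hq0 : 0 ≤ q := by
    rw [hq, sub_nonneg, div_le_one hs0]; exact hs
  -- `g n` is the full tail `∑_{m ≥ n} (m + 1)² q ^ m`.
  let g : ℕ → ℝ := fun n => s * (((n : ℝ) + 1) ^ 2 + 2 * (n + 1) * (s - 1) +
    (s - 1) * (2 * s - 1)) * q ^ n
  have hg0 (n : ℕ) : 0 ≤ g n := by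
    have h1 : 0 ≤ s - 1 := by linarith
    have h2 : 0 ≤ 2 * s - 1 := by linarith
    positivity
  have hstep (n : ℕ) : ((n : ℝ) + 1) ^ 2 * q ^ n = g n - g (n + 1) := by
    have hsq : s * q = s - 1 := by rw [hq]; field_simp
    simp only [g, pow_succ q n]
    push_cast
    linear_combination (((n : ℝ) + 1 + 1) ^ 2 + 2 * (n + 1 + 1) * (s - 1) +
      (s - 1) * (2 * s - 1)) * q ^ n * hsq
  have hsum : ∑ n ∈ Finset.Ico R N, ((n : ℝ) + 1) ^ 2 * q ^ n ≤ g R := by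
    rcases le_total R N with h | h
    · simp only [hstep]
      have := Finset.sum_Ico_sub g h
      have h2 : ∑ n ∈ Finset.Ico R N, (g n - g (n + 1)) = g R - g N := by
        rw [← neg_inj, ← Finset.sum_neg_distrib, neg_sub, ← this]
        exact Finset.sum_congr rfl fun _ _ => by ring
      linarith [hg0 N]
    · simpa [Finset.Ico_eq_empty_of_le h] using hg0 R
  refine hsum.trans (mul_le_mul_of_nonneg_right ?_ (pow_nonneg hq0 R))
  have hR : (1 : ℝ) ≤ R := hs.trans hsR
  rw [mul_comm 5 s, mul_assoc s 5]
  refine mul_le_mul_of_nonneg_left ?_ hs0.le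
  nlinarith [mul_nonneg (sub_nonneg.mpr hsR) (by linarith : (0 : ℝ) ≤ s - 1)]

theorem sum_Ico_sq_mul_exp_le {ξ : ℝ} (hξ : 0 < ξ) {R : ℕ} (hR : 2 * ξ + 1 ≤ R) (N : ℕ) :
    ∑ n ∈ Finset.Ico R N, ((n : ℝ) + 1) ^ 2 * Real.exp (-(n : ℝ) / (2 * ξ)) ≤
      10 * (ξ + 1) * R ^ 2 * Real.exp (-(R : ℝ) / (2 * ξ)) := by
  set q := Real.exp (-(1 / (2 * ξ))) with hq
  have hx : 0 < 1 / (2 * ξ) := by positivity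
  have hq0 : 0 < q := Real.exp_pos _
  have hq1 : q < 1 := by simpa [hq] using hξ
  have hexp (n : ℕ) : Real.exp (-(n : ℝ) / (2 * ξ)) = q ^ n := by
    rw [hq, ← Real.exp_nat_mul]
    congr 1
    ring
  set s := 1 / (1 - q) with hs
  have h1q : 0 < 1 - q := by linarith
  have hs1 : 1 ≤ s := by
    rw [hs, le_div_iff₀ h1q]; linarith
  have hs2 : s ≤ 2 * ξ + 1 := by
    have h1 : 1 / (2 * ξ) + 1 ≤ q⁻¹ := by
      rw [hq, ← Real.exp_neg, neg_neg]; exact Real.add_one_le_exp _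
    have h2 : (1 / (2 * ξ) + 1) * q ≤ 1 := by
      calc _ ≤ q⁻¹ * q := mul_le_mul_of_nonneg_right h1 hq0.le
        _ = 1 := inv_mul_cancel₀ hq0.ne'
    rw [hs, div_le_iff₀ h1q]
    have h3 : (2 * ξ) * ((1 / (2 * ξ) + 1) * q) ≤ 2 * ξ * 1 :=
      mul_le_mul_of_nonneg_left h2 (by positivity)
    have h4 : (2 * ξ) * ((1 / (2 * ξ) + 1) * q) = (1 + 2 * ξ) * q := by field_simp
    linarith
  have hsq : 1 - 1 / s = q := by rw [hs, one_div_one_div]; ring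
  have h := sum_Ico_sq_mul_pow_le hs1 (hs2.trans hR) N
  rw [hsq] at h
  simp only [hexp]
  refine h.trans (mul_le_mul_of_nonneg_right ?_ (pow_nonneg hq0.le R))
  exact mul_le_mul_of_nonneg_right (by linarith) (sq_nonneg _)

/-- Every edge `X` is counted at the site of `A` that is closest to it; edges at infinite distance do
not contribute. -/
theorem sum_decay_le (S : LatticeSystem V σ) {M : ℝ} (hgrowth : S.QuadraticGrowth M)
    (A : Finset V) {ξ : ℝ} (hξ : 0 < ξ) {R : ℕ} (hR : 2 * ξ + 1 ≤ R) (G : Finset (Finset V))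
    (hG : G ⊆ S.edges) (hGR : ∀ X ∈ G, R ≤ S.setDist X A) :
    ∑ X ∈ G, decay (2 * ξ) (S.setDist X A) ≤
      M * A.card * (10 * (ξ + 1) * R ^ 2 * Real.exp (-(R : ℝ) / (2 * ξ))) := by
  have h1 : ∑ X ∈ G, decay (2 * ξ) (S.setDist X A) ≤
      ∑ X ∈ G, ∑ a ∈ A, decay (2 * ξ) (S.distTo a X) := by
    refine Finset.sum_le_sum fun X _ => ?_
    by_cases h : S.setDist X A = ⊤
    · rw [decay, if_pos h]
      exact Finset.sum_nonneg fun a _ => decay_nonneg _ _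
    · obtain ⟨a, ha, hd⟩ := S.exists_distTo_eq_setDist h
      rw [← hd]
      exact Finset.single_le_sum (f := fun a => decay (2 * ξ) (S.distTo a X))
        (fun a _ => decay_nonneg _ _) ha
  refine h1.trans ?_
  rw [Finset.sum_comm, mul_comm M, mul_assoc, ← nsmul_eq_mul]
  refine Finset.sum_le_card_nsmul _ _ _ fun a ha => ?_
  set F := {X ∈ G | S.distTo a X ≠ ⊤} with hF
  -- A bound for the finitely many distances that occur.
  set N := F.sup (fun X => (S.distTo a X).toNat) + 1 with hN
  have h2 : ∑ X ∈ G, decay (2 * ξ) (S.distTo a X) = ∑ X ∈ F, decay (2 * ξ) (S.distTo a X) := by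
    rw [hF, Finset.sum_filter]
    refine Finset.sum_congr rfl fun X _ => ?_
    split_ifs with h
    · rfl
    · rw [decay, if_pos (not_not.mp h)]
  have hmaps : ∀ X ∈ F, (S.distTo a X).toNat ∈ Finset.Ico R N := by
    intro X hX
    obtain ⟨hXG, hXt⟩ := Finset.mem_filter.mp hX
    refine Finset.mem_Ico.mpr ⟨?_, Nat.lt_succ_of_le
      (Finset.le_sup (f := fun X => (S.distTo a X).toNat) hX)⟩
    have h := (hGR X hXG).trans (S.setDist_le_distTo ha)
    rw [← ENat.natCast_toNat hXt] at h
    exact_mod_cast h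
  rw [h2, ← Finset.sum_fiberwise_of_maps_to hmaps]
  refine le_trans ?_ (mul_le_mul_of_nonneg_left (sum_Ico_sq_mul_exp_le hξ hR N) ?_)
  · rw [Finset.mul_sum]
    refine Finset.sum_le_sum fun n _ => ?_
    have h3 : ∀ X ∈ F.filter (fun X => (S.distTo a X).toNat = n),
        decay (2 * ξ) (S.distTo a X) = Real.exp (-(n : ℝ) / (2 * ξ)) := by
      intro X hX
      obtain ⟨hXF, hXn⟩ := Finset.mem_filter.mp hX
      rw [decay, if_neg (Finset.mem_filter.mp hXF).2, hXn]
    rw [Finset.sum_congr rfl h3, Finset.sum_const, nsmul_eq_mul, ← mul_assoc]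
    refine mul_le_mul_of_nonneg_right (le_trans ?_ (hgrowth a n)) (Real.exp_nonneg _)
    refine Nat.cast_le.mpr (Finset.card_le_card fun X hX => ?_)
    obtain ⟨hXF, hXn⟩ := Finset.mem_filter.mp hX
    obtain ⟨hXG, hXt⟩ := Finset.mem_filter.mp hXF
    exact Finset.mem_filter.mpr ⟨hG hXG, by rw [← hXn, ENat.natCast_toNat hXt]⟩
  · have h := (Nat.cast_nonneg _).trans (hgrowth a 0)
    simpa using h

end LatticeSystem

end Geometry

/-! ### Responses of the reduced state -/

section Fisher

open Matrix
open scoped ComplexOrder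

variable {V : Type*} [Fintype V] [DecidableEq V] {σ : V → Type*} [∀ x, DecidableEq (σ x)]
  [∀ x, Fintype (σ x)]

namespace LatticeSystem

theorem opNorm_term_le_strength (S : LatticeSystem V σ) {X : Finset V} (hX : X ∈ S.edges) :
    opNorm (S.term X) ≤ S.strength :=
  le_ciSup (f := fun X : {X // X ∈ S.edges} => opNorm (S.term X)) (Set.finite_range _).bddAbove
    ⟨X, hX⟩

theorem strength_nonneg (S : LatticeSystem V σ) : 0 ≤ S.strength :=
  Real.iSup_nonneg fun _ => norm_nonneg _

variable [∀ x, Nonempty (σ x)]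

/-- The response `Tr_{Aᶜ} (symMul (O - ⟨O⟩) ω)` of the reduced state of `A` to the observable `O`.
The derivative of the reduced state is minus the response to the Hamiltonian. -/
noncomputable def response (S : LatticeSystem V σ) (A : Finset V) (β : ℝ) (O : GlobalOp σ) :
    LocalOp σ A :=
  partialTrace A (symMul (S.centered β O) (S.gibbs β))

theorem reduced_posSemidef (S : LatticeSystem V σ) (A : Finset V) (β : ℝ) :
    (S.reduced A β).PosSemidef :=
  ((S.gibbs_posDef β).partialTrace A).posSemidef

theorem buresNorm_response_of_supportedIn (S : LatticeSystem V σ) (A : Finset V) (β : ℝ)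
    {O : GlobalOp σ} (hO : O.IsHermitian) (hOA : SupportedIn A O) :
    buresNorm (S.reduced_isHermitian A β) (S.response A β O) = √(S.variance β O) := by
  obtain ⟨k, hk, hkO⟩ :=
    (hOA.sub_smul_one (S.expect β O)).exists_isHermitian (S.centered_isHermitian β hO)
  rw [variance_eq_centered, response, centered, hkO]
  exact buresNorm_partialTrace_embedOp A (S.gibbs_posDef β) hk

theorem buresNorm_response_le (S : LatticeSystem V σ) (A : Finset V) (β : ℝ)
    {O : GlobalOp σ} (hO : O.IsHermitian) :
    buresNorm (S.reduced_isHermitian A β) (S.response A β O) ≤ √(S.variance β O) := by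
  rw [variance_eq_centered]
  exact buresNorm_partialTrace_le A (S.gibbs_posDef β) (S.centered_isHermitian β hO)

/-- Exponential clustering bounds the squared norm, whence the decay at half the rate. -/
theorem buresNorm_response_term_le (S : LatticeSystem V σ) (A : Finset V) {β ξ : ℝ}
    (hξ : S.IsCorrelationLength β ξ) {X : Finset V} (hX : X ∈ S.edges) (hXA : Disjoint X A) :
    buresNorm (S.reduced_isHermitian A β) (S.response A β (S.term X)) ≤
      2 * S.strength * √(S.maxBoundary : ℝ) * √(ξ + 1) * decay (2 * ξ) (S.setDist X A) := by
  obtain ⟨hξ0, hcorr⟩ := hξ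
  have hJ := S.opNorm_term_le_strength hX
  have hJ0 := S.strength_nonneg
  have hPX := S.supportedIn_term X hX
  have hP := S.isHermitian_term X hX
  obtain ⟨K, hK, hKJ, hB⟩ := exists_opNorm_le_buresNorm_sq_le hXA (S.gibbs_posDef β)
    (S.trace_gibbs β) hP hPX hJ0 hJ
  have hmin : ((min (S.boundary X).card (S.boundary A).card : ℕ) : ℝ) ≤ S.maxBoundary :=
    Nat.cast_le.mpr ((min_le_left _ _).trans
      (Finset.le_sup (f := fun X => (S.boundary X).card) hX))
  have hd := decay_nonneg ξ (S.setDist X A)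
  have hc := hcorr X A (S.term X) (embedOp A K) hXA hP hK.embedOp hPX ⟨K, rfl⟩
  have hP0 : 0 ≤ opNorm (S.term X) := norm_nonneg _
  have hK0 : 0 ≤ opNorm (embedOp A K) := norm_nonneg _
  have hsq : buresNorm (S.reduced_isHermitian A β) (S.response A β (S.term X)) ^ 2 ≤
      4 * (ξ + 1) * S.maxBoundary * S.strength * S.strength * decay ξ (S.setDist X A) := by
    refine (hB.trans hc).trans ?_
    gcongr
  refine le_of_sq_le_sq (hsq.trans_eq ?_) (by
    rw [← sqrt_decay]; positivity)
  rw [← sqrt_decay, mul_pow, mul_pow, mul_pow, mul_pow, Real.sq_sqrt (Nat.cast_nonneg _),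
    Real.sq_sqrt (by linarith), Real.sq_sqrt hd]
  ring

end LatticeSystem

end Fisher

theorem theorem1 {V : Type*} [Fintype V] [DecidableEq V] {σ : V → Type*}
    [∀ x, Fintype (σ x)] [∀ x, DecidableEq (σ x)] [∀ x, Nonempty (σ x)]
    (S : LatticeSystem V σ) (M : ℝ) (hM : 0 < M) (hgrowth : S.QuadraticGrowth M)
    (βstar : ℝ) (ξ : ℝ → ℝ) (hξ : ∀ β : ℝ, |β| < βstar → S.IsCorrelationLength β (ξ β))
    (A : Finset V) (β : ℝ) (hβ : |β| < βstar) (R : ℕ) (hR : 2 * ξ β + 1 ≤ (R : ℝ)) :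
    |√(S.fisher A β) - √(S.variance β (S.ham (S.innerEdges A)))| ≤
      √(S.variance β (S.ham (S.layer A R))) +
        40 * S.strength * M * (A.card : ℝ) * √(S.maxBoundary : ℝ) *
          (ξ β + 1) ^ (3 / 2 : ℝ) * (R : ℝ) ^ 2 * Real.exp (-(R : ℝ) / (2 * ξ β)) := by
  have hcl := hξ β hβ
  have hξ0 := hcl.1
  set x := ξ β
  have hpsd := S.reduced_posSemidef A β
  have hinner : S.innerEdges A ⊆ S.edges := Finset.filter_subset _ _
  have hlayer : S.layer A R ⊆ S.edges \ S.innerEdges A := Finset.filter_subset _ _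
  set far := (S.edges \ S.innerEdges A) \ S.layer A R with hfar
  have hfarE : far ⊆ S.edges := Finset.sdiff_subset.trans Finset.sdiff_subset
  have hfarR : ∀ X ∈ far, (R : ℕ∞) ≤ S.setDist X A := by
    intro X hX
    obtain ⟨h1, h2⟩ := Finset.mem_sdiff.mp hX
    by_contra h
    exact h2 (Finset.mem_filter.mpr ⟨h1, not_le.mp h⟩)
  -- Sets that meet have distance `0`, whereas `R ≥ 2 ξ + 1 > 0`.
  have hfarA : ∀ X ∈ far, Disjoint X A := by
    intro X hX
    refine S.disjoint_of_setDist_ne_zero fun h => ?_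
    have h1 := hfarR X hX
    rw [h] at h1
    have h2 : R = 0 := by exact_mod_cast le_antisymm h1 zero_le
    rw [h2, Nat.cast_zero] at hR
    linarith
  have hham : S.ham S.edges =
      S.ham (S.innerEdges A) + (S.ham (S.layer A R) + ∑ X ∈ far, S.term X) := by
    unfold LatticeSystem.ham
    rw [← Finset.sum_sdiff hinner, ← Finset.sum_sdiff hlayer]
    abel
  have hderiv : S.reducedDeriv A β = -(S.response A β (S.ham (S.innerEdges A)) +
      (S.response A β (S.ham (S.layer A R)) + ∑ X ∈ far, S.response A β (S.term X))) := by
    rw [S.reducedDeriv_eq, hham]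
    have hadd (O P : GlobalOp σ) : S.centered β (O + P) = S.centered β O + S.centered β P := by
      simpa using S.centered_sum β Finset.univ ![O, P]
    rw [hadd, hadd, S.centered_sum, symMul_add_left, symMul_add_left, symMul_sum_left,
      partialTrace_add, partialTrace_add, partialTrace_sum]
    rfl
  have hsqrt : √(S.fisher A β) =
      buresNorm (S.reduced_isHermitian A β) (S.reducedDeriv A β) :=
    Real.sqrt_sq (buresNorm_nonneg _ _)
  rw [hsqrt, hderiv, ← S.buresNorm_response_of_supportedIn A β (S.ham_isHermitian hinner)
    (supportedIn_sum A _ _ fun X hX => (S.supportedIn_term X (hinner hX)).mono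
      (Finset.mem_filter.mp hX).2)]
  refine (abs_buresNorm_neg_add_sub_le hpsd _ _).trans ((buresNorm_add_le hpsd _ _).trans
    (add_le_add (S.buresNorm_response_le A β
      (S.ham_isHermitian (hlayer.trans Finset.sdiff_subset))) ?_))
  refine (buresNorm_sum_le hpsd _ _).trans ((Finset.sum_le_sum fun X hX =>
    S.buresNorm_response_term_le A hcl (hfarE hX) (hfarA X hX)).trans ?_)
  have hJ0 := S.strength_nonneg
  rw [← Finset.mul_sum]
  refine (mul_le_mul_of_nonneg_left (S.sum_decay_le hgrowth A hξ0 hR far hfarE hfarR)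
    (by positivity)).trans ?_
  have hpow : (x + 1) ^ (3 / 2 : ℝ) = (x + 1) * √(x + 1) := by
    rw [show (3 / 2 : ℝ) = 1 + 1 / 2 by norm_num, Real.rpow_add (by linarith), Real.rpow_one,
      Real.sqrt_eq_rpow]
  rw [hpow]
  have hnn : 0 ≤ S.strength * M * A.card * √(S.maxBoundary : ℝ) * ((x + 1) * √(x + 1)) *
      (R : ℝ) ^ 2 * Real.exp (-(R : ℝ) / (2 * x)) := by positivity
  linarith
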